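/- Let $q$ be a prime power with $q \equiv 1 \pmod 4$ and let $g_1 = x^2 + ax + 1 \in \mathbb{F}_q[x]$ be irreducible over $\mathbb{F}_q$. For $k \ge 1$ define recursively $g_{k+1} = g_k^R$, where $g^R$ denotes Cohen's $R$-transform $$g^R(x) = (2x)^{\deg g}\, g\!\left(\tfrac12\left(x + \tfrac1x\right)\right).$$ Then for every $k \ge 1$ the polynomial $g_k$ is irreducible over $\mathbb{F}_q$ of degree $n = 2^k$, and every root $\alpha \in \mathbb{F}_{q^n}$ of $g_k$ is completely normal in the extension $\mathbb{F}_{q^n}/\mathbb{F}_q$; that is, for every divisor $d$ of $n$, the elements $\alpha, \alpha^{Q}, \alpha^{Q^2}, \ldots, \alpha^{Q^{n/d-1}}$, where $Q = q^d$, are linearly independent over $\mathbb{F}_{q^d}$. -/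

import Mathlib

open Polynomial

/-- Cohen's `R`-transform `g ↦ (2x)^n * g((x + 1/x)/2)`, where `n = deg g`, written out as a
polynomial: `(2x)^n * ((x + 1/x)/2)^i = (2x)^(n-i) * (x^2+1)^i` for `i ≤ n`.
See `aeval_cohenRTransform` for the defining identity. -/
noncomputable def cohenRTransform {F : Type*} [Field F] (g : F[X]) : F[X] :=
  ∑ i ∈ Finset.range (g.natDegree + 1),
    C (g.coeff i) * (2 * X) ^ (g.natDegree - i) * (X ^ 2 + 1) ^ i

/-- The defining identity of the transform, at every nonzero point of every field extension
of odd characteristic (in particular at the indeterminate of the rational function field). -/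
theorem aeval_cohenRTransform {F E : Type*} [Field F] [Field E] [Algebra F E]
    (h2 : (2 : E) ≠ 0) (g : F[X]) (x : E) (hx : x ≠ 0) :
    aeval x (cohenRTransform g) = (2 * x) ^ g.natDegree * aeval ((x + 1 / x) / 2) g := by
  rw [aeval_eq_sum_range (p := g) ((x + 1 / x) / 2), Finset.mul_sum, cohenRTransform, map_sum]
  refine Finset.sum_congr rfl fun i hi => ?_
  have hi' : i ≤ g.natDegree := by
    have := Finset.mem_range.1 hi
    omega
  have h : x ^ 2 + 1 = (2 * x) * ((x + 1 / x) / 2) := by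
    field_simp
  simp only [map_mul, map_pow, map_add, map_one, map_ofNat, aeval_X, aeval_C, Algebra.smul_def]
  rw [h, mul_pow (2 * x) _ i, ← Nat.sub_add_cancel hi', pow_add, Nat.add_sub_cancel]
  ring

/-- For a finite extension `L / K` of finite fields, of degree `m`, with `|K| = Q`: the element
`α` is normal in `L / K` if `α, α^Q, …, α^(Q^(m-1))` are linearly independent over `K`. -/
def IsNormalElement (K L : Type*) [Field K] [Field L] [Algebra K L] (α : L) : Prop :=
  LinearIndependent K (fun i : Fin (Module.finrank K L) => α ^ (Nat.card K ^ (i : ℕ)))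

/-- `α` is completely normal in `L / K` if it is normal in `L / M` for every intermediate
field `M` (for `K = 𝔽_q`, `L = 𝔽_{q^n}` these are the fields `𝔽_{q^d}` with `d ∣ n`). -/
def IsCompletelyNormalElement (K L : Type*) [Field K] [Field L] [Algebra K L] (α : L) : Prop :=
  ∀ M : IntermediateField K L, IsNormalElement M L α

/-!
The Cayley transform `x ↦ (x - 1) / (x + 1)` turns `y ↦ (y + 1 / y) / 2` into squaring, so for a
root `α` of `g k` the element `β = (α - 1) / (α + 1)` is a `2 ^ k`-th root of the nonsquare
`(a + 2) / (a - 2)`. As `-1` is a square, `X ^ 2 ^ k - C b` is irreducible for every nonsquare `b`;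
hence `α` has degree `2 ^ k`, and over an intermediate field `M` with `[L : M] = n` the element `β`
is an `n`-th root of a nonsquare `c` of `M`.

Expanding `α = (1 + β) / (1 - β)` gives
`(1 - c) α = (1 + c) + 2 (β + β ^ 2 + ⋯ + β ^ (n - 1))`, a combination with nonzero coefficients of
the basis of powers of `β`. Each `β ^ i` is killed by some irreducible `X ^ 2 ^ d - C ξ` evaluated
at the Frobenius of `M`. A polynomial in the Frobenius that kills `α` therefore kills every
`β ^ i`, so it is the zero operator, which is the normality of `α` over `M`.
-/

section Annihilator

variable {K V : Type*} [Field K] [AddCommGroup V] [Module K V] {T : Module.End K V}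

theorem aeval_apply_eq_zero_of_dvd {p q : K[X]} (hpq : p ∣ q) {v : V} (hv : aeval T p v = 0) :
    aeval T q v = 0 := by
  obtain ⟨r, rfl⟩ := hpq
  rw [mul_comm, aeval_mul, Module.End.mul_apply, hv, map_zero]

theorem dvd_of_aeval_apply_eq_zero {p q : K[X]} (hp : Irreducible p) {v : V} (hv : v ≠ 0)
    (hpv : aeval T p v = 0) (hqv : aeval T q v = 0) : p ∣ q := by
  by_contra hpq
  have hdisj := disjoint_ker_aeval_of_isCoprime T (hp.coprime_iff_not_dvd.2 hpq)
  exact hv (Submodule.disjoint_def.1 hdisj v hpv hqv)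

open scoped Classical in
/-- The components of `∑ i, a i • b i` on which `p i` does not vanish are removed by the product `h`
of their annihilators; `p i` does not divide `h`, so it divides `f`. -/
theorem aeval_eq_zero_of_aeval_apply_sum_smul_basis_eq_zero {ι : Type*} [Fintype ι]
    (b : Module.Basis ι K V) {p : ι → K[X]} (hp : ∀ i, Irreducible (p i))
    (hpb : ∀ i, aeval T (p i) (b i) = 0) {a : ι → K} (ha : ∀ i, a i ≠ 0) {f : K[X]}
    (hf : aeval T f (∑ i, a i • b i) = 0) : aeval T f = 0 := by
  refine b.ext fun i => ?_
  let S : Finset ι := {j | aeval T (p i) (b j) = 0}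
  let y : V := ∑ j ∈ S, a j • b j
  let h : K[X] := ∏ j ∈ Sᶜ, p j
  have hy : y ≠ 0 := fun hy0 =>
    ha i (linearIndependent_iff'.1 b.linearIndependent S a hy0 i (by simpa [S] using hpb i))
  have hpy : aeval T (p i) y = 0 := by
    rw [map_sum]
    exact Finset.sum_eq_zero fun j hj => by
      rw [map_smul, (Finset.mem_filter.1 hj).2, smul_zero]
  have hsum : aeval T h (∑ j, a j • b j) = aeval T h y := by
    rw [← Finset.sum_add_sum_compl S, map_add, add_eq_left, map_sum]
    exact Finset.sum_eq_zero fun j hj => by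
      rw [map_smul, aeval_apply_eq_zero_of_dvd (Finset.dvd_prod_of_mem p hj) (hpb j), smul_zero]
  have hfhy : aeval T (f * h) y = 0 := by
    rw [aeval_mul, Module.End.mul_apply, ← hsum, ← Module.End.mul_apply, ← aeval_mul, mul_comm,
      aeval_mul, Module.End.mul_apply, hf, map_zero]
  have hph : ¬p i ∣ h := (hp i).prime.not_dvd_finsetProd fun j hj hij =>
    (Finset.mem_compl.1 hj) (by
      simpa [S] using aeval_apply_eq_zero_of_dvd ((hp i).associated_of_dvd (hp j) hij).symm.dvd
        (hpb j))
  have hpf : p i ∣ f :=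
    ((hp i).prime.dvd_or_dvd (dvd_of_aeval_apply_eq_zero (hp i) hy hpy hfhy)).resolve_right hph
  exact aeval_apply_eq_zero_of_dvd hpf (hpb i)

end Annihilator

section TwoPowerRoots

/-- In a quadratic extension generated by `x = √a`, the relation `x = y ^ 2` would give
`-a = N(x) = N(y) ^ 2`. -/
theorem irreducible_X_pow_two_pow_sub_C {K : Type*} [Field K] (hK : IsSquare (-1 : K)) {a : K}
    (ha : ¬IsSquare a) (d : ℕ) : Irreducible (X ^ 2 ^ d - C a) := by
  induction d generalizing K with
  | zero => simpa using irreducible_X_sub_C a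
  | succ d ih =>
    have hquad : Irreducible (X ^ 2 - C a) := X_pow_sub_C_irreducible_of_prime Nat.prime_two
      fun b hb => ha ⟨b, by rw [← hb, sq]⟩
    rw [pow_succ]
    refine X_pow_mul_sub_C_irreducible hquad fun E _ _ x hx => ih ?_ ?_
    · simpa using hK.map (algebraMap K (IntermediateField.adjoin K {x}))
    · rintro ⟨y, hy⟩
      have hint : IsIntegral K x := by
        by_contra h
        exact X_pow_sub_C_ne_zero two_pos a (hx.symm.trans (minpoly.eq_zero h))
      have hnorm : Algebra.norm K (IntermediateField.AdjoinSimple.gen K x) = -a := by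
        rw [← IntermediateField.adjoin.powerBasis_gen hint,
          Algebra.PowerBasis.norm_gen_eq_coeff_zero_minpoly]
        simp [IntermediateField.minpoly_gen, hx]
      refine ha ?_
      rw [← neg_neg a, ← hnorm, hy, map_mul, ← neg_one_mul]
      exact hK.mul (IsSquare.mul_self _)

variable {K L : Type*} [Field K] [Field L] [Algebra K L]

theorem minpoly_eq_X_pow_two_pow_sub_C (hK : IsSquare (-1 : K)) {a : K} (ha : ¬IsSquare a) {d : ℕ}
    {x : L} (hx : x ^ 2 ^ d = algebraMap K L a) : minpoly K x = X ^ 2 ^ d - C a :=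
  (minpoly.eq_of_irreducible_of_monic (irreducible_X_pow_two_pow_sub_C hK ha d) (by simp [hx])
    (monic_X_pow_sub_C a (by positivity))).symm

theorem natDegree_minpoly_eq_two_pow (hK : IsSquare (-1 : K)) {a : K} (ha : ¬IsSquare a) {d : ℕ}
    {x : L} (hx : x ^ 2 ^ d = algebraMap K L a) : (minpoly K x).natDegree = 2 ^ d := by
  rw [minpoly_eq_X_pow_two_pow_sub_C hK ha hx, natDegree_X_pow_sub_C]

theorem two_pow_le_finrank [FiniteDimensional K L] (hK : IsSquare (-1 : K)) {a : K}
    (ha : ¬IsSquare a) {d : ℕ} {x : L} (hx : x ^ 2 ^ d = algebraMap K L a) :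
    2 ^ d ≤ Module.finrank K L :=
  natDegree_minpoly_eq_two_pow hK ha hx ▸ minpoly.natDegree_le x

/-- `w ^ ((q + 1) / 2) = ±η`, and `(q + 1) / 2` is odd while `w` has 2-power order. -/
theorem mem_range_algebraMap_of_pow_eq_mul {q s : ℕ} (hq : q ≡ 1 [MOD 4]) {x w : L} (hx : x ≠ 0)
    (hxw : x ^ q = w * x) (hw : w ^ 2 ^ s = 1) {η : K}
    (hη : x ^ (q * q) = algebraMap K L (η * η) * x) : w ∈ (algebraMap K L).range := by
  obtain ⟨m, rfl⟩ : ∃ m, q = 4 * m + 1 := ⟨q / 4, by unfold Nat.ModEq at hq; omega⟩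
  have hwη : w ^ (2 * m + 1) * w ^ (2 * m + 1) = algebraMap K L η * algebraMap K L η := by
    rw [pow_mul, hxw, mul_pow, hxw, ← mul_assoc] at hη
    rw [← map_mul, ← mul_right_cancel₀ hx hη]
    ring
  have hmem : w ^ (2 * m + 1) ∈ (algebraMap K L).range := by
    rcases mul_self_eq_mul_self_iff.1 hwη with h | h
    · exact ⟨η, h.symm⟩
    · exact ⟨-η, by rw [h, map_neg]⟩
  have hcop : (2 * m + 1).Coprime (orderOf w) :=
    Nat.Coprime.coprime_dvd_right (orderOf_dvd_of_pow_eq_one hw)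
      (Nat.Coprime.pow_right _ (by simp))
  obtain ⟨r, hr⟩ := exists_pow_eq_self_of_coprime hcop
  exact hr ▸ pow_mem hmem r

end TwoPowerRoots

section FiniteField

variable {K : Type*} [Field K] [Finite K]

theorem two_ne_zero_of_natCard_modEq (hK : Nat.card K ≡ 1 [MOD 4]) : (2 : K) ≠ 0 := by
  have := Fintype.ofFinite K
  rw [Nat.card_eq_fintype_card] at hK
  refine Ring.two_ne_zero fun h => ?_
  have := FiniteField.even_card_of_char_two h
  unfold Nat.ModEq at hK
  omega

theorem isSquare_neg_one_of_natCard_modEq (hK : Nat.card K ≡ 1 [MOD 4]) :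
    IsSquare (-1 : K) := by
  have := Fintype.ofFinite K
  rw [Nat.card_eq_fintype_card] at hK
  rw [FiniteField.isSquare_neg_one_iff]
  unfold Nat.ModEq at hK
  omega

variable {L : Type*} [Field L] [Algebra K L]

theorem pow_natCard_pow_eq_self_iff_natDegree_minpoly_dvd {x : L} (hx : IsIntegral K x) {n : ℕ} :
    x ^ Nat.card K ^ n = x ↔ (minpoly K x).natDegree ∣ n := by
  rw [(minpoly.irreducible hx).natDegree_dvd_iff_dvd_X_pow_card_pow_sub_X, minpoly.dvd_iff]
  simp [sub_eq_zero]

variable [FiniteDimensional K L]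

theorem mem_of_natDegree_minpoly_eq_finrank (M : IntermediateField K L) {x : L}
    (hx : (minpoly K x).natDegree = Module.finrank K M) : x ∈ M := by
  have : Finite M := Module.finite_of_finite K
  have hfix : x ^ Nat.card M ^ 1 = x := by
    rw [pow_one, Module.natCard_eq_pow_finrank (K := K),
      pow_natCard_pow_eq_self_iff_natDegree_minpoly_dvd (.of_finite K x), hx]
  have hdeg := Nat.dvd_one.1
    ((pow_natCard_pow_eq_self_iff_natDegree_minpoly_dvd (.of_finite M x)).1 hfix)
  obtain ⟨y, rfl⟩ := minpoly.natDegree_eq_one_iff.1 hdeg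
  exact y.2

theorem exists_not_isSquare_algebraMap_eq_pow (hK : IsSquare (-1 : K)) {b : K} (hb : ¬IsSquare b)
    {M : IntermediateField K L} {j s : ℕ} (hM : Module.finrank K M = 2 ^ j) {β : L}
    (hβ : β ^ 2 ^ (j + s) = algebraMap K L b) :
    ∃ c : M, ¬IsSquare c ∧ β ^ 2 ^ s = algebraMap M L c := by
  have hpow : (β ^ 2 ^ s) ^ 2 ^ j = algebraMap K L b := by rw [← hβ]; ring
  have hmem : β ^ 2 ^ s ∈ M := mem_of_natDegree_minpoly_eq_finrank M
    (hM ▸ natDegree_minpoly_eq_two_pow hK hb hpow)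
  refine ⟨⟨_, hmem⟩, ?_, rfl⟩
  rintro ⟨e, he⟩
  have hroot : e ^ 2 ^ (j + 1) = algebraMap K M b := by
    rw [pow_succ', pow_mul, sq, ← he]
    exact Subtype.ext hpow
  have hle := two_pow_le_finrank hK hb hroot
  rw [hM] at hle
  exact absurd hle (Nat.pow_lt_pow_right one_lt_two j.lt_succ_self).not_ge

end FiniteField

section NormalElement

/-- The Frobenius `x ↦ x ^ |K|` as a `K`-linear map, so that polynomials over `K` act on `L`. -/
noncomputable def frobeniusEnd (K L : Type*) [Field K] [Finite K] [Field L] [Algebra K L] :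
    Module.End K L :=
  letI := Fintype.ofFinite K
  (FiniteField.frobeniusAlgHom K L).toLinearMap

variable {K L : Type*} [Field K] [Finite K] [Field L] [Algebra K L]

theorem frobeniusEnd_pow_apply (n : ℕ) (x : L) :
    (frobeniusEnd K L ^ n) x = x ^ Nat.card K ^ n := by
  have := Fintype.ofFinite K
  induction n with
  | zero => simp
  | succ n ih =>
    rw [pow_succ', Module.End.mul_apply, ih, pow_succ, pow_mul, frobeniusEnd,
      Subsingleton.elim (Fintype.ofFinite K) ‹_›, Nat.card_eq_fintype_card]
    simp

theorem aeval_frobeniusEnd_X_pow_sub_C (n : ℕ) (ξ : K) (x : L) :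
    aeval (frobeniusEnd K L) (X ^ n - C ξ) x = x ^ Nat.card K ^ n - algebraMap K L ξ * x := by
  simp [frobeniusEnd_pow_apply, Algebra.smul_def]

/-- For the least `d` for which such a `ξ` exists, `X ^ 2 ^ d - C ξ` is irreducible: if `d > 0`,
then `ξ` is not a square. -/
theorem exists_irreducible_aeval_frobeniusEnd_eq_zero (hK : Nat.card K ≡ 1 [MOD 4]) {δ : L}
    (hδ : δ ≠ 0) {s : ℕ} {e : K} (hδe : δ ^ 2 ^ s = algebraMap K L e) {d : ℕ} {ξ : K}
    (hδξ : δ ^ Nat.card K ^ 2 ^ d = algebraMap K L ξ * δ) :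
    ∃ p : K[X], Irreducible p ∧ aeval (frobeniusEnd K L) p δ = 0 := by
  induction d generalizing ξ with
  | zero =>
    refine ⟨X ^ 1 - C ξ, by simpa using irreducible_X_sub_C ξ, ?_⟩
    rw [aeval_frobeniusEnd_X_pow_sub_C, sub_eq_zero, ← hδξ, pow_zero]
  | succ d ih =>
    by_cases hξ : IsSquare ξ
    · obtain ⟨η, rfl⟩ := hξ
      set q := Nat.card K ^ 2 ^ d
      have hq : q ≡ 1 [MOD 4] := by simpa using hK.pow (2 ^ d)
      have hδq : δ ^ q = δ ^ q / δ * δ := (div_mul_cancel₀ _ hδ).symm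
      have hw : (δ ^ q / δ) ^ 2 ^ s = 1 := by
        have hfix : algebraMap K L e ^ q = algebraMap K L e := by
          have := Fintype.ofFinite K
          rw [← map_pow, show q = Fintype.card K ^ 2 ^ d by simp [q], FiniteField.pow_card_pow]
        rw [div_pow, ← pow_mul, mul_comm, pow_mul, hδe, hfix, ← hδe, div_self (pow_ne_zero _ hδ)]
      obtain ⟨w, hwq⟩ := mem_range_algebraMap_of_pow_eq_mul hq hδ hδq hw
        (by rw [← hδξ, ← sq, ← pow_mul, ← pow_succ])
      exact ih (hwq ▸ hδq)
    · refine ⟨X ^ 2 ^ (d + 1) - C ξ,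
        irreducible_X_pow_two_pow_sub_C (isSquare_neg_one_of_natCard_modEq hK) hξ _, ?_⟩
      rw [aeval_frobeniusEnd_X_pow_sub_C, hδξ, sub_self]

variable [FiniteDimensional K L]

theorem natDegree_minpoly_frobeniusEnd :
    (minpoly K (frobeniusEnd K L)).natDegree = Module.finrank K L := by
  have := Fintype.ofFinite K
  have : Finite L := Module.finite_of_finite K
  rw [frobeniusEnd, Subsingleton.elim (Fintype.ofFinite K) ‹_›,
    FiniteField.minpoly_frobeniusAlgHom, ← C_1, natDegree_X_pow_sub_C]

theorem isNormalElement_of_forall_aeval_frobeniusEnd {α : L}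
    (hα : ∀ f : K[X], aeval (frobeniusEnd K L) f α = 0 → aeval (frobeniusEnd K L) f = 0) :
    IsNormalElement K L α := by
  have hindep : LinearIndependent K
      fun i : Fin (Module.finrank K L) => frobeniusEnd K L ^ (i : ℕ) := by
    have := linearIndependent_pow (K := K) (frobeniusEnd K L)
    rwa [natDegree_minpoly_frobeniusEnd] at this
  rw [Fintype.linearIndependent_iff] at hindep
  refine Fintype.linearIndependent_iff.2 fun g hg => hindep g ?_
  have hf := hα (∑ i, C (g i) * X ^ (i : ℕ)) (by
    simpa [frobeniusEnd_pow_apply] using hg)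
  simpa [Algebra.smul_def] using hf

theorem isNormalElement_sum_smul_basis (hK : Nat.card K ≡ 1 [MOD 4]) {s : ℕ}
    (hs : Module.finrank K L = 2 ^ s) {ι : Type*} [Fintype ι] (b : Module.Basis ι K L) {e : ι → K}
    (hb : ∀ i, b i ^ 2 ^ s = algebraMap K L (e i)) {a : ι → K} (ha : ∀ i, a i ≠ 0) :
    IsNormalElement K L (∑ i, a i • b i) := by
  have hfix (x : L) : x ^ Nat.card K ^ 2 ^ s = algebraMap K L 1 * x := by
    have : Finite L := Module.finite_of_finite K
    have := Fintype.ofFinite L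
    rw [← hs, ← Module.natCard_eq_pow_finrank, Nat.card_eq_fintype_card, FiniteField.pow_card,
      map_one, one_mul]
  choose p hp hpb using fun i =>
    exists_irreducible_aeval_frobeniusEnd_eq_zero hK (b.ne_zero i) (hb i) (hfix (b i))
  exact isNormalElement_of_forall_aeval_frobeniusEnd fun f hf =>
    aeval_eq_zero_of_aeval_apply_sum_smul_basis_eq_zero b hp hpb ha hf

end NormalElement

section Cayley

/-- The Cayley transform, which conjugates the map `y ↦ (y + 1 / y) / 2` underlying Cohen's
`R`-transform into squaring. Its value at the pole `-1` is `0`. -/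
def cayley {E : Type*} [Field E] (x : E) : E :=
  (x - 1) / (x + 1)

theorem cayley_add_one_div_div_two {E : Type*} [Field E] (h2 : (2 : E) ≠ 0) {x : E} (hx : x ≠ 0) :
    cayley ((x + 1 / x) / 2) = cayley x ^ 2 := by
  have hsub : (x + 1 / x) / 2 - 1 = (x - 1) ^ 2 / (2 * x) := by field_simp; ring
  have hadd : (x + 1 / x) / 2 + 1 = (x + 1) ^ 2 / (2 * x) := by field_simp; ring
  rw [cayley, cayley, hsub, hadd, div_div_div_cancel_right₀ (mul_ne_zero h2 hx), div_pow]

theorem mul_one_sub_cayley {E : Type*} [Field E] {x : E} (hx : x + 1 ≠ 0) :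
    x * (1 - cayley x) = 1 + cayley x := by
  rw [cayley]
  field_simp
  ring

theorem one_sub_pow_mul_eq_sum {R : Type*} [CommRing R] {x y : R} (hxy : y * (1 - x) = 1 + x)
    {n : ℕ} (hn : n ≠ 0) :
    (1 - x ^ n) * y = ∑ k ∈ Finset.range n, (if k = 0 then 1 + x ^ n else 2) * x ^ k := by
  obtain ⟨n, rfl⟩ := Nat.exists_eq_add_one_of_ne_zero hn
  have hgeom : (1 - x ^ (n + 1)) * y = (∑ k ∈ Finset.range (n + 1), x ^ k) * (1 + x) := by
    rw [← hxy, ← geom_sum_mul_neg]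
    ring
  rw [hgeom, mul_add, mul_one, Finset.sum_mul, Finset.sum_range_succ', Finset.sum_range_succ _ n,
    Finset.sum_range_succ']
  simp only [pow_zero, mul_one, if_true, Nat.add_eq_zero_iff, one_ne_zero, and_false, if_false,
    ← Finset.mul_sum, ← pow_succ]
  ring

variable {K L : Type*} [Field K] [Finite K] [Field L] [Algebra K L]

theorem isNormalElement_of_mul_one_sub_eq_one_add (hK : Nat.card K ≡ 1 [MOD 4]) {c : K}
    (hc : ¬IsSquare c) {s : ℕ} (hs : Module.finrank K L = 2 ^ s) {α β : L}
    (hαβ : α * (1 - β) = 1 + β) (hβ : β ^ 2 ^ s = algebraMap K L c) : IsNormalElement K L α := by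
  have hneg := isSquare_neg_one_of_natCard_modEq hK
  have hc1 : 1 - c ≠ 0 := sub_ne_zero.2 fun h => hc (h ▸ IsSquare.one)
  have : FiniteDimensional K L := Module.finite_of_finrank_pos (by rw [hs]; positivity)
  have hindep : LinearIndependent K fun i : Fin (2 ^ s) => β ^ (i : ℕ) := by
    have := linearIndependent_pow (K := K) β
    rwa [natDegree_minpoly_eq_two_pow hneg hc hβ] at this
  let b := basisOfLinearIndependentOfCardEqFinrank hindep (by simp [hs])
  have hb (i : Fin (2 ^ s)) : b i ^ 2 ^ s = algebraMap K L (c ^ (i : ℕ)) := by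
    rw [coe_basisOfLinearIndependentOfCardEqFinrank, map_pow, ← hβ, pow_right_comm]
  let a : Fin (2 ^ s) → K := fun i => if (i : ℕ) = 0 then 1 + c else 2
  have ha (i : Fin (2 ^ s)) : a i ≠ 0 := by
    dsimp only [a]
    split_ifs
    · exact fun h => hc (by rwa [← eq_neg_of_add_eq_zero_right h] at hneg)
    · exact two_ne_zero_of_natCard_modEq hK
  have hsum : (1 - c) • α = ∑ i, a i • b i := by
    rw [Algebra.smul_def, map_sub, map_one, ← hβ, one_sub_pow_mul_eq_sum hαβ (by positivity), hβ,
      Finset.sum_range]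
    refine Finset.sum_congr rfl fun i _ => ?_
    simp [a, b, Algebra.smul_def, apply_ite (algebraMap K L), map_ofNat (algebraMap K L) 2]
  have hα : α = ∑ i, ((1 - c)⁻¹ * a i) • b i := by
    simp only [mul_smul, ← Finset.smul_sum, ← hsum, inv_smul_smul₀ hc1]
  rw [hα]
  exact isNormalElement_sum_smul_basis hK hs b hb fun i => mul_ne_zero (inv_ne_zero hc1) (ha i)

theorem isCompletelyNormalElement_of_cayley_pow (hK : Nat.card K ≡ 1 [MOD 4]) {b : K}
    (hb : ¬IsSquare b) {k : ℕ} (hk : Module.finrank K L = 2 ^ k) {α : L}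
    (hα : cayley α ^ 2 ^ k = algebraMap K L b) : IsCompletelyNormalElement K L α := by
  intro M
  have : FiniteDimensional K L := Module.finite_of_finrank_pos (by rw [hk]; positivity)
  have : Finite M := Module.finite_of_finite K
  have hmul := Module.finrank_mul_finrank K M L
  rw [hk] at hmul
  obtain ⟨j, -, hj⟩ := (Nat.dvd_prime_pow Nat.prime_two).1 (Dvd.intro _ hmul)
  obtain ⟨s, -, hs⟩ := (Nat.dvd_prime_pow Nat.prime_two).1 (Dvd.intro_left _ hmul)
  obtain rfl : j + s = k := by
    rw [hj, hs, ← pow_add] at hmul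
    exact Nat.pow_right_injective le_rfl hmul
  have hM : Nat.card M ≡ 1 [MOD 4] := by
    rw [Module.natCard_eq_pow_finrank (K := K)]
    simpa using hK.pow (Module.finrank K M)
  obtain ⟨c, hc, hcα⟩ := exists_not_isSquare_algebraMap_eq_pow
    (isSquare_neg_one_of_natCard_modEq hK) hb hj hα
  have hα1 : α + 1 ≠ 0 := fun h => hb <| by
    rw [cayley, h, div_zero, zero_pow (by positivity), eq_comm, map_eq_zero] at hα
    exact hα ▸ IsSquare.zero
  exact isNormalElement_of_mul_one_sub_eq_one_add hM hc hs (mul_one_sub_cayley hα1) hcα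

end Cayley

section CohenTransform

variable {F : Type*} [Field F]

theorem cohenRTransform_eq_sum_add (g : F[X]) :
    cohenRTransform g = ∑ i ∈ Finset.range g.natDegree,
        C (g.coeff i) * (2 * X) ^ (g.natDegree - i) * (X ^ 2 + 1) ^ i +
      C g.leadingCoeff * (X ^ 2 + 1) ^ g.natDegree := by
  rw [cohenRTransform, Finset.sum_range_succ, Nat.sub_self, pow_zero, mul_one, leadingCoeff]

theorem degree_lower_terms_cohenRTransform_lt (g : F[X]) :
    (∑ i ∈ Finset.range g.natDegree,
        C (g.coeff i) * (2 * X) ^ (g.natDegree - i) * (X ^ 2 + 1) ^ i).degree <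
      ((2 * g.natDegree : ℕ) : WithBot ℕ) := by
  refine (degree_sum_le _ _).trans_lt ?_
  refine (Finset.sup_lt_iff (WithBot.bot_lt_coe _)).2 fun i hi => ?_
  have hi' := Finset.mem_range.1 hi
  have hlin : (2 * X : F[X]).natDegree ≤ 1 := by compute_degree
  have hquad : (X ^ 2 + 1 : F[X]).natDegree ≤ 2 := by compute_degree
  have hterm := natDegree_mul_le_of_le
    (natDegree_mul_le_of_le (natDegree_C (g.coeff i)).le
      (natDegree_pow_le_of_le (g.natDegree - i) hlin))
    (natDegree_pow_le_of_le i hquad)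
  exact degree_le_natDegree.trans_lt (by exact_mod_cast (by omega))

theorem natDegree_cohenRTransform (g : F[X]) :
    (cohenRTransform g).natDegree = 2 * g.natDegree := by
  rcases eq_or_ne g 0 with rfl | hg
  · simp [cohenRTransform]
  have hquad : (X ^ 2 + 1 : F[X]).natDegree = 2 := by compute_degree!
  have hlead : (C g.leadingCoeff * (X ^ 2 + 1) ^ g.natDegree).natDegree = 2 * g.natDegree := by
    rw [natDegree_C_mul (leadingCoeff_ne_zero.2 hg), natDegree_pow, hquad, mul_comm]
  have hlead0 : C g.leadingCoeff * (X ^ 2 + 1) ^ g.natDegree ≠ 0 :=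
    mul_ne_zero (C_ne_zero.2 (leadingCoeff_ne_zero.2 hg))
      (pow_ne_zero _ (ne_zero_of_natDegree_gt (n := 1) (by omega)))
  rw [cohenRTransform_eq_sum_add, natDegree_add_eq_right_of_degree_lt, hlead]
  rw [degree_eq_natDegree hlead0, hlead]
  exact degree_lower_terms_cohenRTransform_lt g

theorem natDegree_iterate_cohenRTransform (g : F[X]) (k : ℕ) :
    (cohenRTransform^[k] g).natDegree = 2 ^ k * g.natDegree := by
  induction k with
  | zero => simp
  | succ k ih =>
    rw [Function.iterate_succ_apply', natDegree_cohenRTransform, ih, pow_succ', mul_assoc]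

variable {E : Type*} [Field E] [Algebra F E]

theorem aeval_zero_cohenRTransform (g : F[X]) :
    aeval (0 : E) (cohenRTransform g) = algebraMap F E g.leadingCoeff := by
  rw [cohenRTransform_eq_sum_add, map_add, map_sum, Finset.sum_eq_zero fun i hi => ?_]
  · simp
  · simp [zero_pow (Nat.sub_ne_zero_of_lt (Finset.mem_range.1 hi))]

theorem aeval_zero_cohenRTransform_ne_zero {g : F[X]} (hg : g ≠ 0) :
    aeval (0 : E) (cohenRTransform g) ≠ 0 := by
  rw [aeval_zero_cohenRTransform]
  exact (_root_.map_ne_zero (algebraMap F E)).2 (leadingCoeff_ne_zero.2 hg)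

theorem cohenRTransform_ne_zero {g : F[X]} (hg : g ≠ 0) : cohenRTransform g ≠ 0 := fun h =>
  aeval_zero_cohenRTransform_ne_zero (E := F) hg (by rw [h, map_zero])

theorem exists_cayley_eq_sq_of_aeval_cohenRTransform (h2 : (2 : E) ≠ 0) {g : F[X]} (hg : g ≠ 0)
    {x : E} (hx : aeval x (cohenRTransform g) = 0) :
    ∃ y : E, aeval y g = 0 ∧ cayley y = cayley x ^ 2 := by
  have hx0 : x ≠ 0 := by
    rintro rfl
    exact aeval_zero_cohenRTransform_ne_zero hg hx
  rw [aeval_cohenRTransform h2 g x hx0] at hx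
  exact ⟨(x + 1 / x) / 2, (mul_eq_zero.1 hx).resolve_left (pow_ne_zero _ (mul_ne_zero h2 hx0)),
    cayley_add_one_div_div_two h2 hx0⟩

theorem exists_cayley_eq_pow_of_aeval_iterate_cohenRTransform (h2 : (2 : E) ≠ 0) {g : F[X]}
    (hg : g ≠ 0) {k : ℕ} {x : E} (hx : aeval x (cohenRTransform^[k] g) = 0) :
    ∃ y : E, aeval y g = 0 ∧ cayley y = cayley x ^ 2 ^ k := by
  induction k generalizing g with
  | zero => exact ⟨x, hx, by simp⟩
  | succ k ih =>
    obtain ⟨y, hy, hyx⟩ := ih (cohenRTransform_ne_zero hg) hx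
    obtain ⟨z, hz, hzy⟩ := exists_cayley_eq_sq_of_aeval_cohenRTransform h2 hg hy
    exact ⟨z, hz, by rw [hzy, hyx, ← pow_mul, pow_succ]⟩

end CohenTransform

section QuadraticSeed

variable {F : Type*} [Field F] {a : F}

theorem natDegree_X_sq_add_C_mul_X_add_one (a : F) :
    (X ^ 2 + C a * X + 1 : F[X]).natDegree = 2 := by
  compute_degree!

theorem not_isSquare_add_two_div_sub_two (h2 : (2 : F) ≠ 0)
    (ha : Irreducible (X ^ 2 + C a * X + 1 : F[X])) : ¬IsSquare ((a + 2) / (a - 2)) := by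
  have hroot (x : F) : x ^ 2 + a * x + 1 ≠ 0 := fun hx =>
    ha.not_isRoot_of_natDegree_ne_one (by simp [natDegree_X_sq_add_C_mul_X_add_one])
      (x := x) (by simpa [IsRoot] using hx)
  have ha2 : a - 2 ≠ 0 := fun h => hroot (-1) (by linear_combination -h)
  rintro ⟨e, he⟩
  have he' : a + 2 = e * e * (a - 2) := by rw [← he, div_mul_cancel₀ _ ha2]
  refine hroot ((-a + e * (a - 2)) / 2) ?_
  field_simp
  linear_combination (-(a - 2)) * he'

variable {E : Type*} [Field E] [Algebra F E]

theorem cayley_sq_of_aeval_eq_zero (ha : a ≠ 2) {x : E}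
    (hx : aeval x (X ^ 2 + C a * X + 1) = 0) :
    cayley x ^ 2 = algebraMap F E ((a + 2) / (a - 2)) := by
  have ha2 : algebraMap F E a - 2 ≠ 0 := by
    rw [← map_ofNat (algebraMap F E) 2, ← map_sub]
    exact (_root_.map_ne_zero _).2 (sub_ne_zero.2 ha)
  simp only [map_add, map_mul, map_pow, aeval_X, aeval_C, map_one] at hx
  have hx1 : x + 1 ≠ 0 := fun h =>
    ha2 (by linear_combination -hx + (x + algebraMap F E a - 1) * h)
  rw [cayley, map_div₀, map_add, map_sub, map_ofNat, div_pow,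
    div_eq_div_iff (pow_ne_zero _ hx1) ha2]
  linear_combination -4 * hx

theorem cayley_pow_of_aeval_iterate_cohenRTransform (h2 : (2 : F) ≠ 0) (ha : a ≠ 2) {k : ℕ} {x : E}
    (hx : aeval x (cohenRTransform^[k] (X ^ 2 + C a * X + 1)) = 0) :
    cayley x ^ 2 ^ (k + 1) = algebraMap F E ((a + 2) / (a - 2)) := by
  have h2E : (2 : E) ≠ 0 := by
    rw [← map_ofNat (algebraMap F E) 2]
    exact (_root_.map_ne_zero _).2 h2
  have hg : (X ^ 2 + C a * X + 1 : F[X]) ≠ 0 :=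
    ne_zero_of_natDegree_gt (n := 1) (by rw [natDegree_X_sq_add_C_mul_X_add_one]; simp)
  obtain ⟨y, hy, hyx⟩ := exists_cayley_eq_pow_of_aeval_iterate_cohenRTransform h2E hg hx
  rw [pow_succ, pow_mul, ← hyx, cayley_sq_of_aeval_eq_zero ha hy]

end QuadraticSeed

section Irreducibility

universe u

theorem irreducible_of_forall_natDegree_le_finrank {F : Type u} [Field F] {g : F[X]}
    (hg : g.natDegree ≠ 0)
    (h : ∀ (E : Type u) [Field E] [Algebra F E] [FiniteDimensional F E] (x : E),
      aeval x g = 0 → g.natDegree ≤ Module.finrank F E) : Irreducible g := by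
  obtain ⟨p, hp, hpg⟩ := exists_irreducible_of_natDegree_ne_zero hg
  have : Fact (Irreducible p) := ⟨hp⟩
  have := (AdjoinRoot.powerBasis hp.ne_zero).finite
  have hroot : aeval (AdjoinRoot.root p) g = 0 := by
    rwa [AdjoinRoot.aeval_eq, AdjoinRoot.mk_eq_zero]
  have hle := h _ _ hroot
  rw [(AdjoinRoot.powerBasis hp.ne_zero).finrank, AdjoinRoot.powerBasis_dim] at hle
  exact (associated_of_dvd_of_natDegree_le hpg (by rintro rfl; simp at hg) hle).irreducible hp

theorem irreducible_iterate_cohenRTransform {F : Type*} [Field F] (hF : IsSquare (-1 : F))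
    (h2 : (2 : F) ≠ 0) {a : F} (ha : ¬IsSquare ((a + 2) / (a - 2))) (k : ℕ) :
    Irreducible (cohenRTransform^[k] (X ^ 2 + C a * X + 1)) := by
  have ha2 : a ≠ 2 := by
    rintro rfl
    simp at ha
  have hdeg : (cohenRTransform^[k] (X ^ 2 + C a * X + 1)).natDegree = 2 ^ (k + 1) := by
    rw [natDegree_iterate_cohenRTransform, natDegree_X_sq_add_C_mul_X_add_one, pow_succ]
  refine irreducible_of_forall_natDegree_le_finrank (by simp [hdeg]) fun E _ _ _ x hx => ?_
  rw [hdeg]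
  exact two_pow_le_finrank hF ha (cayley_pow_of_aeval_iterate_cohenRTransform h2 ha2 hx)

end Irreducibility

theorem mainTheorem4 {F : Type*} [Field F] [Finite F] (hq : Nat.card F ≡ 1 [MOD 4])
    (a : F) (ha : Irreducible (X ^ 2 + C a * X + 1 : F[X]))
    (g : ℕ → F[X]) (hg1 : g 1 = X ^ 2 + C a * X + 1)
    (hg : ∀ k, 1 ≤ k → g (k + 1) = cohenRTransform (g k))
    (k : ℕ) (hk : 1 ≤ k) :
    Irreducible (g k) ∧ (g k).natDegree = 2 ^ k ∧
      ∀ (L : Type*) [Field L] [Algebra F L], Module.finrank F L = (g k).natDegree →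
        ∀ α : L, aeval α (g k) = 0 → IsCompletelyNormalElement F L α := by
  have h2 := two_ne_zero_of_natCard_modEq hq
  have hb := not_isSquare_add_two_div_sub_two h2 ha
  obtain ⟨m, rfl⟩ := Nat.exists_eq_add_of_le' hk
  have hgm : g (m + 1) = cohenRTransform^[m] (X ^ 2 + C a * X + 1) := by
    induction m with
    | zero => exact hg1
    | succ m ih => rw [hg _ m.succ_pos, ih m.succ_pos, Function.iterate_succ_apply']
  have hdeg : (g (m + 1)).natDegree = 2 ^ (m + 1) := by
    rw [hgm, natDegree_iterate_cohenRTransform, natDegree_X_sq_add_C_mul_X_add_one, pow_succ]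
  refine ⟨?_, hdeg, fun L _ _ hL α hα => ?_⟩
  · rw [hgm]
    exact irreducible_iterate_cohenRTransform (isSquare_neg_one_of_natCard_modEq hq) h2 hb m
  · rw [hgm] at hα
    exact isCompletelyNormalElement_of_cayley_pow hq hb (hL.trans hdeg)
      (cayley_pow_of_aeval_iterate_cohenRTransform h2 (by rintro rfl; simp at hb) hα)
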